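/- Let $\mathcal D=(V,E)$ be a directed acyclic graph on $V=\{1,\dots,d\}$; $i$ is an ancestor of $j$ if there is a directed path of length at least one from $i$ to $j$, and $j$ is a source node if it has no parents. Let $\boldsymbol Z=(Z_1,\dots,Z_d)$ be a random vector with independent non-negative components that are standardised with index $2$, i.e. $n\,\mathbb P(n^{-1/2}Z_i>z)\to z^{-2}$ as $n\to\infty$ for every $z>0$. Let $\boldsymbol X$ be the linear structural equation model with positive edge weights (LSEM+) on $\mathcal D$ with innovations $\boldsymbol Z$: $$X_i=\sum_{j\in\mathrm{pa}(i)}c_{ij}X_j+s_{ii}Z_i,\qquad i\in V,\qquad c_{ij}>0\ \text{for } (j,i)\in E,\quad s_{ii}>0,$$ and put $c_{ij}=0$ for $(j,i)\notin E$, so that $\boldsymbol X=A\boldsymbol Z$ with $A=(I-C)^{-1}S$, where $C=(c_{ij})$ and $S=\mathrm{diag}(s_{11},\dots,s_{dd})$. Assume that the components of $\boldsymbol X$ are standardised as well, $n\,\mathbb P(n^{-1/2}X_i>x)\to x^{-2}$ for every $x>0$. Then $\boldsymbol X$ is regularly varying with index $2$: with $\|\cdot\|$ the Euclidean norm and $\Theta_+^{d-1}=\{\boldsymbol\omega\in\mathbb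 R_+^d:\|\boldsymbol\omega\|=1\}$, there is a finite measure $H_{\boldsymbol X}$ on $\Theta_+^{d-1}$ (the angular measure) such that $$n\,\mathbb P\big((\|\boldsymbol X\|/\sqrt n,\ \boldsymbol X/\|\boldsymbol X\|)\in\cdot\big)\ \to\ 2x^{-3}\,dx\times H_{\boldsymbol X}$$ vaguely on $(0,\infty]\times\Theta_+^{d-1}$. For $i,j\in V$ and $a\ge 1$ let $M_{i,aj}=\max(X_i,aX_j)$ and $M_{ij}=M_{i,1j}$, with squared scaling $$\sigma^2_{M_{i,aj}}=\int_{\Theta_+^{d-1}}\max(\omega_i^2,a^2\omega_j^2)\,dH_{\boldsymbol X}(\boldsymbol\omega).$$ Let $j\in V$. Then $j$ is a source node if and only if there exists a scalar $a>1$ such that $$\sigma^2_{M_{i,aj}}-\sigma^2_{M_{ij}}=a^2-1\qquad\text{for all } i\neq j.$$ If $j$ is not a source node, then for every $a>1$ and every $i\ne j$ one has $\sigma^2_{M_{i,aj}}-\sigma^2_{M_{ij}}\le a^2-1$, with strict inequality if $i$ is an ancestor of $j$. -/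

import Mathlib

open MeasureTheory ProbabilityTheory Filter Topology
open scoped ENNReal

namespace ExtremeLSEM

/-- `G.Adj j i` is the edge `j → i`. The digraph is a DAG when no node lies on a directed cycle. -/
def IsDAG {V : Type*} (G : Digraph V) : Prop :=
  ∀ v, ¬ Relation.TransGen G.Adj v v

/-- `j ∈ an(i)`: there is a directed path of length at least one from `j` to `i`. -/
def IsAncestor {V : Type*} (G : Digraph V) (j i : V) : Prop :=
  Relation.TransGen G.Adj j i

/-- `pa(j) = ∅`. -/
def IsSource {V : Type*} (G : Digraph V) (j : V) : Prop :=
  ∀ i, ¬ G.Adj i j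

/-- `X` is the linear structural equation model with positive edge weights (LSEM+) on the DAG `G`
with edge weight matrix `C`, innovation weights `s` and innovations `Z`:
`X_i = ∑_{j ∈ pa(i)} c_{ij} X_j + s_i Z_i` for every node `i`. -/
structure IsLSEMPlus {Ω : Type*} {d : ℕ} (G : Digraph (Fin d)) (C : Matrix (Fin d) (Fin d) ℝ)
    (s : Fin d → ℝ) (Z X : Ω → EuclideanSpace ℝ (Fin d)) : Prop where
  dag : IsDAG G
  edge_pos : ∀ i j, G.Adj j i → 0 < C i j
  nonedge : ∀ i j, ¬ G.Adj j i → C i j = 0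
  innov_pos : ∀ i, 0 < s i
  eqn : ∀ ω i, X ω i = ∑ j, C i j * X ω j + s i * Z ω i

/-- A real random variable is standardised (with index `α`) when
`n P(n^{-1/α} Y > y) → y^{-α}` for every `y > 0`. -/
def IsStandardised {Ω : Type*} [MeasurableSpace Ω] (P : Measure Ω) (α : ℝ) (Y : Ω → ℝ) : Prop :=
  ∀ y : ℝ, 0 < y →
    Tendsto (fun n : ℕ => (n : ℝ) * P.real {ω | y < (n : ℝ) ^ (-1 / α) * Y ω})
      atTop (𝓝 (y ^ (-α)))

/-- The non-negative part of the Euclidean unit sphere. -/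
def posSphere (d : ℕ) : Set (EuclideanSpace ℝ (Fin d)) :=
  {θ | ‖θ‖ = 1 ∧ ∀ i, 0 ≤ θ i}

/-- The measure `α x^{-α-1} dx` on `(0, ∞)`. -/
noncomputable def radialMeasure (α : ℝ) : Measure ℝ :=
  (volume.restrict (Set.Ioi 0)).withDensity fun x => ENNReal.ofReal (α * x ^ (-α - 1))

/-- `H` is the angular measure of the non-negative random vector `X`, regularly varying with index
`α` and normalising sequence `b_n = n^{1/α}`: `H` is a finite measure carried by the non-negative
unit sphere `Θ`, and `n P((‖X‖ / b_n, X / ‖X‖) ∈ ·)` converges vaguely on `(0, ∞] × Θ` to the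
product of `α x^{-α-1} dx` and `H`. The compactly supported test functions on `(0, ∞] × Θ` are
written as continuous functions on `[0, ∞] × ℝ^d` that vanish for radii below some `δ > 0`; such a
function vanishes where `X = 0`. -/
structure IsAngularMeasure {Ω : Type*} [MeasurableSpace Ω] {d : ℕ} (P : Measure Ω) (α : ℝ)
    (X : Ω → EuclideanSpace ℝ (Fin d)) (H : Measure (EuclideanSpace ℝ (Fin d))) : Prop where
  finite : IsFiniteMeasure H
  carrier : H (posSphere d)ᶜ = 0
  tendsto : ∀ f : C(ℝ≥0∞ × EuclideanSpace ℝ (Fin d), ℝ),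
    (∃ δ : ℝ≥0∞, 0 < δ ∧ ∀ r < δ, ∀ θ, f (r, θ) = 0) →
    Tendsto
      (fun n : ℕ => (n : ℝ) *
        ∫ ω, f (ENNReal.ofReal (‖X ω‖ / (n : ℝ) ^ (1 / α)), ‖X ω‖⁻¹ • X ω) ∂P)
      atTop
      (𝓝 (∫ p, f (ENNReal.ofReal p.1, p.2) ∂((radialMeasure α).prod H)))

/-- The squared scaling `σ²` of the partially rescaled maximum `M_{i,aj} = max(X_i, a X_j)`, for a
random vector `X` with angular measure `H`. The case `a = 1` is the squared scaling of
`M_{ij} = max(X_i, X_j)`. -/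
noncomputable def sqScalingMax {d : ℕ} (H : Measure (EuclideanSpace ℝ (Fin d)))
    (i : Fin d) (a : ℝ) (j : Fin d) : ℝ :=
  ∫ θ, max ((θ i) ^ 2) ((a * θ j) ^ 2) ∂H

end ExtremeLSEM

/-!
The model is solved by `X = A Z`, where `A = (I - C)⁻¹ S` is non-negative and the support of row `i`
of `A` is `i` together with its ancestors; all of this follows by well-founded induction along the
ancestor relation (`IsWeight.exists_coeff`, `IsWeight.isAncestor_of_coeff_ne_zero`,
`IsWeight.coeff_pos_of_isAncestor`).

Regular variation of `X` is the principle of a single big jump (`tendsto_integral_sum_smul`). At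
scale `n^{1/α}` two independent innovations are large together with probability `O(n⁻²)`, so that
asymptotically `X` is extreme only along the rays spanned by the columns `A_k` of `A`, and the
angular measure is `∑ k, ‖A_k‖ ^ α • δ_{A_k / ‖A_k‖}` (`isAngularMeasure_rayMeasure`). A test
function in polar coordinates is uniformly continuous on Euclidean space, because it extends to the
radial compactification (`uniformContinuous_polarFun`); this controls the contribution of the
small innovations. Testing with products of a radial cutoff and a function of the angle shows that
every angular measure has the same angular integrals (`IsAngularMeasure.integral_eq`).

With `α = 2` the squared scalings are therefore `∑ k, max (A_ik², a² A_jk²)`. Comparing the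
one-dimensional limit for `X_i` with the single big jump limit gives `∑ k, A_ik² = 1`
(`sum_rpow_eq_one`). For `a > 1` each summand satisfies
`max (A_ik², a² A_jk²) - max (A_ik², A_jk²) ≤ (a² - 1) A_jk²`, strictly when `0 < A_jk < A_ik`, and
summation gives the inequality. If `i` is an ancestor of `j`, then `A_ij = 0 < A_jj`; since both rows
have norm one, `A_jk < A_ik` for some `k`, and `A_jk > 0` as the support of row `i` lies in that of
row `j`: the inequality is strict. If `j` is a source, its row is the unit vector `e_j`, and
`A_ij ≤ 1` gives equality.
-/

namespace ExtremeLSEM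

/-! ### The radial measure -/

theorem radialMeasure_Ioi {α : ℝ} (hα : 0 < α) {t : ℝ} (ht : 0 < t) :
    radialMeasure α (Set.Ioi t) = ENNReal.ofReal (t ^ (-α)) := by
  have hsub : Set.Ioi t ⊆ Set.Ioi 0 := Set.Ioi_subset_Ioi ht.le
  rw [radialMeasure, withDensity_apply _ measurableSet_Ioi, Measure.restrict_restrict_of_subset hsub,
    ← ofReal_integral_eq_lintegral_ofReal]
  · rw [integral_const_mul, integral_Ioi_rpow_of_lt (by linarith) ht]
    congr 1
    rw [show -α - 1 + 1 = -α by ring]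
    field_simp
  · exact (integrableOn_Ioi_rpow_of_lt (by linarith) ht).const_mul _
  · filter_upwards [ae_restrict_mem measurableSet_Ioi] with x hx
    have : 0 < x := ht.trans hx
    positivity

theorem radialMeasure_real_Ioi {α : ℝ} (hα : 0 < α) {t : ℝ} (ht : 0 < t) :
    (radialMeasure α).real (Set.Ioi t) = t ^ (-α) := by
  rw [Measure.real, radialMeasure_Ioi hα ht, ENNReal.toReal_ofReal (by positivity)]

instance instSFiniteRadialMeasure (α : ℝ) : SFinite (radialMeasure α) := by
  unfold radialMeasure; infer_instance

theorem integral_radialMeasure {α : ℝ} (hα : 0 < α) (g : ℝ → ℝ) :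
    ∫ u, g u ∂(radialMeasure α) = ∫ u in Set.Ioi 0, (α * u ^ (-α - 1)) * g u := by
  rw [radialMeasure, integral_withDensity_eq_integral_toReal_smul (by fun_prop) (by simp)]
  refine setIntegral_congr_fun measurableSet_Ioi fun u hu => ?_
  have hu' : (0 : ℝ) < u := hu
  simp only [smul_eq_mul]
  rw [ENNReal.toReal_ofReal (by positivity)]

/-- The radial measure is homogeneous of order `-α`. -/
theorem integral_radialMeasure_comp_mul {α : ℝ} (hα : 0 < α) (g : ℝ → ℝ) {c : ℝ} (hc : 0 < c) :
    ∫ u, g (c * u) ∂(radialMeasure α) = c ^ α * ∫ u, g u ∂(radialMeasure α) := by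
  rw [integral_radialMeasure hα, integral_radialMeasure hα]
  have h := integral_comp_mul_left_Ioi (fun u => (α * u ^ (-α - 1)) * g u) 0 hc
  simp only [mul_zero, smul_eq_mul] at h
  have h2 : ∫ u in Set.Ioi 0, (α * (c * u) ^ (-α - 1)) * g (c * u) =
      c ^ (-α - 1) * ∫ u in Set.Ioi 0, (α * u ^ (-α - 1)) * g (c * u) := by
    rw [← integral_const_mul]
    refine setIntegral_congr_fun measurableSet_Ioi fun u hu => ?_
    rw [Real.mul_rpow hc.le (le_of_lt hu)]
    ring
  rw [h2] at h
  have h3 : c ^ α * c * c ^ (-α - 1) = 1 := by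
    nth_rewrite 2 [← Real.rpow_one c]
    rw [← Real.rpow_add hc, ← Real.rpow_add hc]
    simp
  calc _ = c ^ α * c * (c ^ (-α - 1) * ∫ u in Set.Ioi 0, (α * u ^ (-α - 1)) * g (c * u)) := by
        rw [← mul_assoc, h3, one_mul]
    _ = _ := by rw [h]; field_simp

theorem integrable_radialMeasure {α : ℝ} (hα : 0 < α) {g : ℝ → ℝ} (hg : Continuous g) {M κ : ℝ}
    (hM : ∀ u, 0 < u → |g u| ≤ M) (hκ : 0 < κ) (h0 : ∀ u ≤ κ, g u = 0) :
    Integrable g (radialMeasure α) := by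
  have : IntegrableOn g (Set.Ioi κ) (radialMeasure α) := by
    refine IntegrableOn.of_bound ?_ hg.aestronglyMeasurable M ?_
    · rw [radialMeasure_Ioi hα hκ]; exact ENNReal.ofReal_lt_top
    · filter_upwards [ae_restrict_mem measurableSet_Ioi] with u hu
      exact hM u (hκ.trans hu)
  refine (integrableOn_iff_integrable_of_support_subset fun u hu => ?_).1 this
  by_contra h
  exact hu (h0 u (not_lt.1 h))

/-! ### Standardised variables and continuous test functions -/

/-- A step function that follows `g` along the `N + 1` grid points `κ, κ + h, …, κ + N * h`. It is
written as a combination of indicators of rays, since tail probabilities are what standardisation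
controls. -/
noncomputable def gridStep (g : ℝ → ℝ) (κ h : ℝ) (N : ℕ) (u : ℝ) : ℝ :=
  ∑ i ∈ Finset.range N, (g (κ + (i + 1) * h) - g (κ + i * h)) *
    (Set.Ioi (κ + i * h)).indicator (fun _ => (1 : ℝ)) u

/-- The increments of `gridStep` telescope: it is `ε`-close to `g` up to `κ + N * h` and constant
afterwards. -/
theorem gridStep_spec {g : ℝ → ℝ} {κ h ε : ℝ} (hh : 0 < h) (hε : 0 ≤ ε)
    (h0 : ∀ u ≤ κ, g u = 0) (hg : ∀ u v, |u - v| ≤ h → |g u - g v| ≤ ε) (N : ℕ) (u : ℝ) :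
    (u ≤ κ → gridStep g κ h N u = 0) ∧
    (u ≤ κ + N * h → |g u - gridStep g κ h N u| ≤ ε) ∧
    (κ + N * h < u → gridStep g κ h N u = g (κ + N * h)) := by
  induction N with
  | zero =>
    simp only [gridStep, Finset.range_zero, Finset.sum_empty, Nat.cast_zero, zero_mul, add_zero]
    exact ⟨fun _ => trivial, fun hu => by simpa [h0 u hu] using hε, fun _ => (h0 κ le_rfl).symm⟩
  | succ N ih =>
    obtain ⟨ih1, ih2, ih3⟩ := ih
    have hs : gridStep g κ h (N + 1) u = gridStep g κ h N u +
        (g (κ + (N + 1) * h) - g (κ + N * h)) *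
          (Set.Ioi (κ + N * h)).indicator (fun _ => (1 : ℝ)) u := by
      simp [gridStep, Finset.sum_range_succ]
    have hN : (0 : ℝ) ≤ N * h := by positivity
    push_cast
    rcases le_or_gt u (κ + N * h) with hu | hu
    · have hz : (Set.Ioi (κ + N * h)).indicator (fun _ => (1 : ℝ)) u = 0 := by
        simp [hu]
      rw [hs, hz, mul_zero, add_zero]
      exact ⟨ih1, fun _ => ih2 hu, fun h' => by nlinarith⟩
    · have hz : (Set.Ioi (κ + N * h)).indicator (fun _ => (1 : ℝ)) u = 1 := by
        simp [hu]
      rw [hs, hz, mul_one, ih3 hu]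
      refine ⟨fun h' => by linarith, fun h' => ?_, fun _ => by ring⟩
      rw [add_sub_cancel]
      refine hg _ _ ?_
      rw [abs_le]; constructor <;> linarith

theorem tendsto_of_approx {a : ℕ → ℝ} {L : ℝ}
    (h : ∀ ε > 0, ∃ b : ℕ → ℝ, ∃ l, Tendsto b atTop (𝓝 l) ∧ (∀ᶠ n in atTop, |a n - b n| ≤ ε) ∧
      |L - l| ≤ ε) : Tendsto a atTop (𝓝 L) := by
  rw [Metric.tendsto_atTop']
  intro ε hε
  obtain ⟨b, l, hb, hab, hL⟩ := h (ε / 4) (by positivity)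
  have h1 := Metric.tendsto_nhds.1 hb (ε / 4) (by positivity)
  obtain ⟨N, hN⟩ := eventually_atTop.1 (h1.and hab)
  refine ⟨N, fun n hn => ?_⟩
  obtain ⟨h2, h3⟩ := hN n hn.le
  rw [Real.dist_eq] at *
  rw [abs_lt] at *
  rw [abs_le] at h3 hL
  constructor <;> linarith

theorem integral_indicator_fun_one {Ω : Type*} [MeasurableSpace Ω] {μ : Measure Ω} {t : Set Ω}
    (ht : MeasurableSet t) : ∫ ω, t.indicator (fun _ => (1 : ℝ)) ω ∂μ = μ.real t :=
  integral_indicator_one ht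

/-- The error of replacing `g` by its step function, in terms of tail masses only. The measure need
not be finite: the lemma serves both for `P` and for the radial measure. -/
theorem integral_sub_gridStep_le {Ω : Type*} [MeasurableSpace Ω] {μ : Measure Ω} {Y : Ω → ℝ}
    (hY : Measurable Y) {g : ℝ → ℝ} (hgc : Continuous g) {M κ h ε : ℝ} (hM : ∀ u, |g u| ≤ M)
    (hfin : μ {ω | κ < Y ω} ≠ ∞)
    (hh : 0 < h) (hε : 0 ≤ ε)
    (h0 : ∀ u ≤ κ, g u = 0) (hg : ∀ u v, |u - v| ≤ h → |g u - g v| ≤ ε) (N : ℕ) :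
    |∫ ω, g (Y ω) ∂μ - ∑ i ∈ Finset.range N, (g (κ + (i + 1) * h) - g (κ + i * h)) *
        μ.real {ω | κ + i * h < Y ω}| ≤
      ε * μ.real {ω | κ < Y ω} + 2 * M * μ.real {ω | κ + N * h < Y ω} := by
  have hM0 : 0 ≤ M := (abs_nonneg _).trans (hM 0)
  have hms : ∀ t, MeasurableSet {ω | t < Y ω} := fun t => measurableSet_lt measurable_const hY
  have hfin' : ∀ i : ℕ, μ {ω | κ + i * h < Y ω} ≠ ∞ := fun i =>
    ne_top_of_le_ne_top hfin (measure_mono fun ω hω => by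
      have : (0 : ℝ) ≤ i * h := by positivity
      simp only [Set.mem_ofPred_eq] at *; linarith)
  have hi : ∀ i : ℕ, Integrable ({ω | κ + i * h < Y ω}.indicator fun _ => (1 : ℝ)) μ := fun i =>
    (integrable_indicator_iff (hms _)).2 (integrableOn_const (hfin' i))
  have hi0 : Integrable ({ω | κ < Y ω}.indicator fun _ => (1 : ℝ)) μ := by simpa using hi 0
  have hstep : ∀ ω, gridStep g κ h N (Y ω) =
      ∑ i ∈ Finset.range N, (g (κ + (i + 1) * h) - g (κ + i * h)) *
        {ω | κ + i * h < Y ω}.indicator (fun _ => (1 : ℝ)) ω := fun ω => by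
    simp [gridStep, Set.indicator_apply]
  have hgi : Integrable (fun ω => g (Y ω)) μ := by
    refine Integrable.mono' (hi0.const_mul M) (hgc.measurable.comp hY).aestronglyMeasurable ?_
    refine Eventually.of_forall fun ω => ?_
    by_cases hω : κ < Y ω
    · simpa [hω] using hM _
    · simp [hω, h0 _ (not_lt.1 hω)]
  have hsi : Integrable (fun ω => gridStep g κ h N (Y ω)) μ := by
    simp only [hstep]
    exact integrable_finsetSum _ fun i _ => (hi i).const_mul _
  have hsum : ∑ i ∈ Finset.range N, (g (κ + (i + 1) * h) - g (κ + i * h)) *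
        μ.real {ω | κ + i * h < Y ω} = ∫ ω, gridStep g κ h N (Y ω) ∂μ := by
    simp only [hstep]
    rw [integral_finsetSum _ fun i _ => (hi i).const_mul _]
    refine Finset.sum_congr rfl fun i _ => ?_
    rw [integral_const_mul, integral_indicator_fun_one (hms _)]
  rw [hsum, ← integral_sub hgi hsi]
  have hR : ε * μ.real {ω | κ < Y ω} + 2 * M * μ.real {ω | κ + N * h < Y ω} =
      ∫ ω, (ε * {ω | κ < Y ω}.indicator (fun _ => (1 : ℝ)) ω +
        2 * M * {ω | κ + N * h < Y ω}.indicator (fun _ => (1 : ℝ)) ω) ∂μ := by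
    rw [integral_add (hi0.const_mul _) ((hi N).const_mul _), integral_const_mul,
      integral_const_mul, integral_indicator_fun_one (hms _), integral_indicator_fun_one (hms _)]
  rw [hR]
  refine (abs_integral_le_integral_abs).trans (integral_mono (hgi.sub hsi).abs
    ((hi0.const_mul _).add ((hi N).const_mul _)) fun ω => ?_)
  obtain ⟨s1, s2, s3⟩ := gridStep_spec hh hε h0 hg N (Y ω)
  have hN : (0 : ℝ) ≤ N * h := by positivity
  simp only [Set.indicator_apply, Set.mem_ofPred_eq]
  rcases le_or_gt (Y ω) κ with h1 | h1
  · rw [s1 h1, h0 _ h1, if_neg (not_lt.2 h1), if_neg (by linarith)]; simp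
  · rw [if_pos h1]
    rcases le_or_gt (Y ω) (κ + N * h) with h2 | h2
    · rw [if_neg (not_lt.2 h2)]; simpa using s2 h2
    · rw [if_pos h2, s3 h2]
      have := (abs_sub (g (Y ω)) (g (κ + N * h))).trans (add_le_add (hM _) (hM _))
      linarith

/-- For a standardised variable the vague convergence of `n P(n^{-1/α} Y ∈ ·)` to the radial
measure, tested on bounded uniformly continuous functions that vanish up to some `κ > 0`. The mass
near `∞` is uniformly small, so no limit of `g` at `∞` is needed. -/
theorem IsStandardised.tendsto_integral {Ω : Type*} [MeasurableSpace Ω] {P : Measure Ω}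
    [IsFiniteMeasure P] {α : ℝ} (hα : 0 < α) {Y : Ω → ℝ} (hY : Measurable Y)
    (hstd : IsStandardised P α Y) {g : ℝ → ℝ} (hg : UniformContinuous g) {M κ : ℝ}
    (hM : ∀ u, |g u| ≤ M) (hκ : 0 < κ) (h0 : ∀ u ≤ κ, g u = 0) :
    Tendsto (fun n : ℕ => (n : ℝ) * ∫ ω, g ((n : ℝ) ^ (-1 / α) * Y ω) ∂P) atTop
      (𝓝 (∫ u, g u ∂(radialMeasure α))) := by
  have hM0 : 0 ≤ M := (abs_nonneg _).trans (hM 0)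
  refine tendsto_of_approx fun ε hε => ?_
  set B : ℝ := κ ^ (-α) + 1 with hB
  have hκα : 0 < κ ^ (-α) := by positivity
  have hB0 : 0 < B := by positivity
  obtain ⟨r, hr, hgr⟩ := Metric.uniformContinuous_iff.1 hg (ε / (2 * B)) (by positivity)
  set h : ℝ := r / 2 with hh
  have hh0 : 0 < h := by positivity
  have hgh : ∀ u v, |u - v| ≤ h → |g u - g v| ≤ ε / (2 * B) := fun u v huv => by
    have := hgr (a := u) (b := v) (by rw [Real.dist_eq]; linarith)
    rw [Real.dist_eq] at this
    exact this.le
  have htail : Tendsto (fun N : ℕ => 2 * M * (κ + N * h) ^ (-α)) atTop (𝓝 (2 * M * 0)) := by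
    refine Tendsto.const_mul _ ((tendsto_rpow_neg_atTop hα).comp ?_)
    exact tendsto_atTop_add_const_left _ _
      (tendsto_natCast_atTop_atTop.atTop_mul_const hh0)
  rw [mul_zero] at htail
  obtain ⟨N, hN⟩ := (htail.eventually (gt_mem_nhds (show (0 : ℝ) < ε / 2 by positivity))).exists
  have hpos : ∀ i : ℕ, 0 < κ + i * h := fun i => by positivity
  refine ⟨fun n => ∑ i ∈ Finset.range N, (g (κ + (i + 1) * h) - g (κ + i * h)) *
      ((n : ℝ) * P.real {ω | κ + i * h < (n : ℝ) ^ (-1 / α) * Y ω}),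
    ∑ i ∈ Finset.range N, (g (κ + (i + 1) * h) - g (κ + i * h)) * (κ + i * h) ^ (-α),
    tendsto_finsetSum _ fun i _ => (hstd _ (hpos i)).const_mul _, ?_, ?_⟩
  · have e1 := (hstd κ hκ).eventually (gt_mem_nhds (show κ ^ (-α) < B by linarith))
    have e2 := ((hstd _ (hpos N)).const_mul (2 * M)).eventually (gt_mem_nhds hN)
    filter_upwards [e1, e2] with n h1 h2
    have hb := integral_sub_gridStep_le (μ := P) (hY.const_mul ((n : ℝ) ^ (-1 / α)))
      hg.continuous hM (measure_ne_top _ _) hh0 (by positivity) h0 hgh N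
    have hn : (0 : ℝ) ≤ n := n.cast_nonneg
    have hb' := mul_le_mul_of_nonneg_left hb hn
    rw [← abs_of_nonneg hn, ← abs_mul, abs_of_nonneg hn, mul_sub, Finset.mul_sum] at hb'
    have hc : ∀ i : ℕ, (n : ℝ) * ((g (κ + (i + 1) * h) - g (κ + i * h)) *
        P.real {ω | κ + i * h < (n : ℝ) ^ (-1 / α) * Y ω}) =
        (g (κ + (i + 1) * h) - g (κ + i * h)) *
        ((n : ℝ) * P.real {ω | κ + i * h < (n : ℝ) ^ (-1 / α) * Y ω}) := fun i => by ring
    simp only [hc] at hb'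
    refine hb'.trans ?_
    have h3 := mul_le_mul_of_nonneg_left h1.le (show 0 ≤ ε / (2 * B) by positivity)
    have h4 : ε / (2 * B) * B = ε / 2 := by field_simp
    rw [h4] at h3
    linarith
  · have hb := integral_sub_gridStep_le (μ := radialMeasure α) measurable_id
      hg.continuous hM (by
        change radialMeasure α (Set.Ioi κ) ≠ ∞
        rw [radialMeasure_Ioi hα hκ]; exact ENNReal.ofReal_ne_top) hh0
      (show 0 ≤ ε / (2 * B) by positivity) h0 hgh N
    have hreal : ∀ t, 0 < t → (radialMeasure α).real {u | t < u} = t ^ (-α) :=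
      fun t ht => radialMeasure_real_Ioi hα ht
    simp only [id, hreal κ hκ, hreal _ (hpos _)] at hb
    refine hb.trans ?_
    have h3 := mul_le_mul_of_nonneg_left (show κ ^ (-α) ≤ B by linarith)
      (show 0 ≤ ε / (2 * B) by positivity)
    have h4 : ε / (2 * B) * B = ε / 2 := by field_simp
    rw [h4] at h3
    linarith

/-! ### The principle of a single big jump -/

theorem norm_sum_smul_le {ι E : Type*} [NormedAddCommGroup E] [NormedSpace ℝ E]
    (t : Finset ι) (v : ι → E) (z : ι → ℝ) {η : ℝ} (hz : ∀ k ∈ t, 0 ≤ z k)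
    (hη : ∀ k ∈ t, z k ≤ η) : ‖∑ k ∈ t, z k • v k‖ ≤ η * ∑ k ∈ t, ‖v k‖ := by
  refine (norm_sum_le _ _).trans ?_
  rw [Finset.mul_sum]
  refine Finset.sum_le_sum fun k hk => ?_
  rw [norm_smul, Real.norm_of_nonneg (hz k hk)]
  exact mul_le_mul_of_nonneg_right (hη k hk) (norm_nonneg _)

/-- Unless two coordinates exceed `η`, at most one summand contributes to `F (∑ k, z k • v k)`, up to
an error `ε` that is present only if some coordinate exceeds `κ`. The level `κ` depends on `δ` but
not on `ε`. -/
theorem abs_apply_sum_sub_sum_apply_le {ι E : Type*} [Fintype ι] [DecidableEq ι]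
    [NormedAddCommGroup E] [NormedSpace ℝ E] (v : ι → E) {F : E → ℝ} {M δ κ η ρ ε : ℝ}
    (hM : ∀ x, |F x| ≤ M) (h0 : ∀ x, ‖x‖ < δ → F x = 0) (hε : 0 ≤ ε) (hκ : 0 ≤ κ)
    (hκδ : κ * ∑ k, ‖v k‖ < δ) (hη : 0 ≤ η) (hηκ : η ≤ κ) (hηρ : η * ∑ k, ‖v k‖ < ρ)
    (hF : ∀ x y, dist x y < ρ → |F x - F y| ≤ ε) (z : ι → ℝ) (hz : ∀ k, 0 ≤ z k) :
    |F (∑ k, z k • v k) - ∑ k, F (z k • v k)| ≤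
      ε * ∑ k, (Set.Ioi κ).indicator (fun _ => (1 : ℝ)) (z k) +
      (1 + Fintype.card ι) * M * ∑ k, ∑ l ∈ Finset.univ.erase k,
        (Set.Ioi η).indicator (fun _ => (1 : ℝ)) (z k) *
          (Set.Ioi η).indicator (fun _ => (1 : ℝ)) (z l) := by
  have hM0 : 0 ≤ M := (abs_nonneg _).trans (hM 0)
  have hind : ∀ a x : ℝ, 0 ≤ (Set.Ioi a).indicator (fun _ => (1 : ℝ)) x := fun a x =>
    Set.indicator_nonneg (fun _ _ => zero_le_one) _
  have hs1 : 0 ≤ ∑ k, (Set.Ioi κ).indicator (fun _ => (1 : ℝ)) (z k) :=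
    Finset.sum_nonneg fun k _ => hind _ _
  have hs2 : ∀ k, 0 ≤ ∑ l ∈ Finset.univ.erase k,
        (Set.Ioi η).indicator (fun _ => (1 : ℝ)) (z k) *
          (Set.Ioi η).indicator (fun _ => (1 : ℝ)) (z l) := fun k =>
    Finset.sum_nonneg fun l _ => mul_nonneg (hind _ _) (hind _ _)
  have hsmall : ∀ k, z k ≤ κ → F (z k • v k) = 0 := fun k hk => by
    refine h0 _ (lt_of_le_of_lt ?_ hκδ)
    rw [norm_smul, Real.norm_of_nonneg (hz k)]
    exact mul_le_mul hk (Finset.single_le_sum (f := fun k => ‖v k‖)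
      (fun _ _ => norm_nonneg _) (Finset.mem_univ k)) (norm_nonneg _) hκ
  -- Two coordinates above `η`; then exactly one above `κ`; then none above `κ`.
  by_cases h2 : ∃ k l, l ≠ k ∧ η < z k ∧ η < z l
  · obtain ⟨k, l, hlk, hk, hl⟩ := h2
    have hone : 1 ≤ ∑ k, ∑ l ∈ Finset.univ.erase k,
        (Set.Ioi η).indicator (fun _ => (1 : ℝ)) (z k) *
          (Set.Ioi η).indicator (fun _ => (1 : ℝ)) (z l) := by
      refine le_trans ?_ (Finset.single_le_sum (fun k _ => hs2 k) (Finset.mem_univ k))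
      refine le_trans ?_ (Finset.single_le_sum
        (fun l _ => mul_nonneg (hind _ _) (hind _ _)) (show l ∈ Finset.univ.erase k by simp [hlk]))
      simp [hk, hl]
    have hb : |F (∑ k, z k • v k) - ∑ k, F (z k • v k)| ≤ (1 + Fintype.card ι) * M := by
      refine (abs_sub _ _).trans ?_
      have : |∑ k, F (z k • v k)| ≤ Fintype.card ι * M := by
        refine (Finset.abs_sum_le_sum_abs _ _).trans ?_
        refine (Finset.sum_le_sum fun k _ => hM (z k • v k)).trans ?_
        simp
      linarith [hM (∑ k, z k • v k)]
    have hc : 0 ≤ (1 + Fintype.card ι) * M := by positivity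
    nlinarith [mul_nonneg hε hs1]
  · push Not at h2
    have hrhs : 0 ≤ (1 + Fintype.card ι) * M * ∑ k, ∑ l ∈ Finset.univ.erase k,
        (Set.Ioi η).indicator (fun _ => (1 : ℝ)) (z k) *
          (Set.Ioi η).indicator (fun _ => (1 : ℝ)) (z l) :=
      mul_nonneg (by positivity) (Finset.sum_nonneg fun k _ => hs2 k)
    refine le_trans ?_ (le_add_of_nonneg_right hrhs)
    by_cases h1 : ∃ k, κ < z k
    · obtain ⟨k, hk⟩ := h1
      have hother : ∀ l ∈ Finset.univ.erase k, z l ≤ η := fun l hl =>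
        h2 k l (Finset.ne_of_mem_erase hl) (hηκ.trans_lt hk)
      have hone : 1 ≤ ∑ k, (Set.Ioi κ).indicator (fun _ => (1 : ℝ)) (z k) := by
        refine le_trans ?_ (Finset.single_le_sum (fun k _ => hind _ _) (Finset.mem_univ k))
        simp [hk]
      have hsum : ∑ k, F (z k • v k) = F (z k • v k) := by
        refine Finset.sum_eq_single k (fun l _ hl => ?_) (by simp)
        exact hsmall l ((hother l (by simp [hl])).trans hηκ)
      rw [hsum]
      refine (hF _ _ ?_).trans (le_mul_of_one_le_right hε hone)
      rw [dist_eq_norm, ← Finset.add_sum_erase _ _ (Finset.mem_univ k), add_sub_cancel_left]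
      refine (norm_sum_smul_le _ v z (fun l _ => hz l) hother).trans_lt (lt_of_le_of_lt ?_ hηρ)
      exact mul_le_mul_of_nonneg_left (Finset.sum_le_sum_of_subset_of_nonneg (by simp)
        fun _ _ _ => norm_nonneg _) hη
    · push Not at h1
      rw [h0 _ ((norm_sum_smul_le _ v z (fun l _ => hz l) fun l _ => h1 l).trans_lt hκδ),
        Finset.sum_eq_zero fun k _ => hsmall k (h1 k)]
      simpa using mul_nonneg hε hs1

/-- Each tail probability is of order `1 / n`, so `n` times their product vanishes: under independence
two standardised variables are not large simultaneously. -/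
theorem IsStandardised.tendsto_joint {Ω : Type*} [MeasurableSpace Ω] {P : Measure Ω}
    {α : ℝ} {Y Y' : Ω → ℝ} (hY : IsStandardised P α Y)
    (hY' : IsStandardised P α Y') {η : ℝ} (hη : 0 < η) :
    Tendsto (fun n : ℕ => (n : ℝ) * (P.real {ω | η < (n : ℝ) ^ (-1 / α) * Y ω} *
      P.real {ω | η < (n : ℝ) ^ (-1 / α) * Y' ω})) atTop (𝓝 0) := by
  have h := ((hY η hη).mul (hY' η hη)).mul tendsto_inv_atTop_nhds_zero_nat
  rw [mul_zero] at h
  refine h.congr' ?_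
  filter_upwards [eventually_ne_atTop 0] with n hn
  have : (n : ℝ) ≠ 0 := by exact_mod_cast hn
  field_simp

/-- The principle of a single big jump: in a linear combination of independent standardised
innovations only one of them is large, so `n P(n^{-1/α} ∑ k, Z k • v k ∈ ·)` converges vaguely to the
sum of the images of the radial measure on the rays through the `v k`. -/
theorem tendsto_integral_sum_smul {Ω ι E : Type*} [MeasurableSpace Ω] {P : Measure Ω}
    [IsProbabilityMeasure P] [Fintype ι] [NormedAddCommGroup E] [NormedSpace ℝ E]
    [FiniteDimensional ℝ E] {α : ℝ} (hα : 0 < α) {Z : ι → Ω → ℝ}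
    (hZm : ∀ k, Measurable (Z k)) (hZ0 : ∀ k ω, 0 ≤ Z k ω) (hind : iIndepFun Z P)
    (hstd : ∀ k, IsStandardised P α (Z k)) (v : ι → E) {F : E → ℝ} (hF : UniformContinuous F)
    {M δ : ℝ} (hM : ∀ x, |F x| ≤ M) (hδ : 0 < δ) (h0 : ∀ x, ‖x‖ < δ → F x = 0) :
    Tendsto (fun n : ℕ => (n : ℝ) * ∫ ω, F ((n : ℝ) ^ (-1 / α) • ∑ k, Z k ω • v k) ∂P) atTop
      (𝓝 (∑ k, ∫ u, F (max u 0 • v k) ∂(radialMeasure α))) := by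
  classical
  have hM0 : 0 ≤ M := (abs_nonneg _).trans (hM 0)
  set K : ℝ := 1 + ∑ k, ‖v k‖ with hK
  have hK0 : 0 < K := by positivity
  have hvK : ∑ k, ‖v k‖ < K := by linarith
  have hvn : 0 ≤ ∑ k, ‖v k‖ := by positivity
  -- The level `κ` is fixed before the accuracy `ε`, so that `n P(Z k > κ n^{1/α})` stays bounded by
  -- about `κ ^ (-α)` while the oscillation of `F` is made small through `η`.
  set κ : ℝ := δ / (2 * K) with hκdef
  have hκ : 0 < κ := by positivity
  have hκK : κ * K = δ / 2 := by rw [hκdef]; field_simp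
  have hκδ : κ * ∑ k, ‖v k‖ < δ := by nlinarith
  set B : ℝ := Fintype.card ι * κ ^ (-α) + 1 with hB
  have hB0 : 0 < B := by positivity
  -- The one-dimensional limits. The maximum with `0` does not change `Z k ≥ 0`; it makes the test
  -- function vanish on the negative half-line.
  have hb : Tendsto (fun n : ℕ => ∑ k, (n : ℝ) *
      ∫ ω, F (max ((n : ℝ) ^ (-1 / α) * Z k ω) 0 • v k) ∂P) atTop
      (𝓝 (∑ k, ∫ u, F (max u 0 • v k) ∂(radialMeasure α))) := by
    refine tendsto_finsetSum _ fun k _ => ?_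
    refine (hstd k).tendsto_integral hα (hZm k) (g := fun u => F (max u 0 • v k)) ?_
      (fun u => hM _) hκ fun u hu => h0 _ ?_
    · have h1 : UniformContinuous fun u : ℝ => max u 0 • v k := by
        refine LipschitzWith.uniformContinuous (K := ‖v k‖₊) (LipschitzWith.of_dist_le_mul ?_)
        intro x y
        rw [dist_eq_norm, ← sub_smul, norm_smul, mul_comm]
        refine mul_le_mul_of_nonneg_left ?_ (norm_nonneg _)
        rw [Real.dist_eq]
        exact abs_max_sub_max_le_abs x y 0
      exact hF.comp h1
    · rw [norm_smul, Real.norm_of_nonneg (le_max_right _ _)]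
      refine lt_of_le_of_lt ?_ hκδ
      exact mul_le_mul (max_le hu hκ.le) (Finset.single_le_sum (f := fun k => ‖v k‖)
        (fun _ _ => norm_nonneg _) (Finset.mem_univ k)) (norm_nonneg _) hκ.le
  refine tendsto_of_approx fun ε hε => ⟨_, _, hb, ?_, by simpa using hε.le⟩
  obtain ⟨ρ, hρ, hFρ⟩ := Metric.uniformContinuous_iff.1 hF (ε / (2 * B)) (by positivity)
  set η : ℝ := min κ (ρ / (2 * K)) with hηdef
  have hη : 0 < η := lt_min hκ (by positivity)
  have hηρ : η * ∑ k, ‖v k‖ < ρ := by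
    have h1 : η * K ≤ ρ / (2 * K) * K := mul_le_mul_of_nonneg_right (min_le_right _ _) hK0.le
    have h2 : ρ / (2 * K) * K = ρ / 2 := by field_simp
    nlinarith
  have hlim1 : Tendsto (fun n : ℕ => ∑ k, (n : ℝ) *
      P.real {ω | κ < (n : ℝ) ^ (-1 / α) * Z k ω}) atTop (𝓝 (Fintype.card ι * κ ^ (-α))) := by
    have := tendsto_finsetSum Finset.univ fun k _ => hstd k κ hκ
    simpa using this
  have hlim2 : Tendsto (fun n : ℕ => (1 + Fintype.card ι) * M * ∑ k, ∑ l ∈ Finset.univ.erase k,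
      (n : ℝ) * (P.real {ω | η < (n : ℝ) ^ (-1 / α) * Z k ω} *
        P.real {ω | η < (n : ℝ) ^ (-1 / α) * Z l ω})) atTop (𝓝 0) := by
    have := (tendsto_finsetSum Finset.univ fun k _ => tendsto_finsetSum (Finset.univ.erase k)
      fun l _ => (hstd k).tendsto_joint (hstd l) hη).const_mul ((1 + Fintype.card ι) * M)
    simpa using this
  have e1 := hlim1.eventually (gt_mem_nhds (show Fintype.card ι * κ ^ (-α) < B by linarith))
  have e2 := hlim2.eventually (gt_mem_nhds (show (0 : ℝ) < ε / 2 by positivity))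
  filter_upwards [e1, e2] with n h1 h2
  set c : ℝ := (n : ℝ) ^ (-1 / α) with hc
  have hc0 : 0 ≤ c := by positivity
  have hcZ : ∀ k ω, 0 ≤ c * Z k ω := fun k ω => mul_nonneg hc0 (hZ0 k ω)
  have hms : ∀ t k, MeasurableSet {ω | t < c * Z k ω} := fun t k =>
    measurableSet_lt measurable_const ((hZm k).const_mul c)
  have hFm : ∀ G : Ω → E, StronglyMeasurable G → Integrable (fun ω => F (G ω)) P := fun G hG =>
    Integrable.of_bound (hF.continuous.comp_stronglyMeasurable hG).aestronglyMeasurable M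
      (Eventually.of_forall fun ω => hM _)
  have hi1 : Integrable (fun ω => F (c • ∑ k, Z k ω • v k)) P := by
    refine hFm _ (StronglyMeasurable.const_smul ?_ c)
    exact Finset.stronglyMeasurable_fun_sum _ fun k _ =>
      (hZm k).stronglyMeasurable.smul stronglyMeasurable_const
  have hi2 : ∀ k, Integrable (fun ω => F (max (c * Z k ω) 0 • v k)) P := fun k =>
    hFm _ ((((hZm k).const_mul c).max measurable_const).stronglyMeasurable.smul
      stronglyMeasurable_const)
  have hpt : ∀ ω, |F (c • ∑ k, Z k ω • v k) - ∑ k, F (max (c * Z k ω) 0 • v k)| ≤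
      ε / (2 * B) * ∑ k, {ω | κ < c * Z k ω}.indicator (fun _ => (1 : ℝ)) ω +
      (1 + Fintype.card ι) * M * ∑ k, ∑ l ∈ Finset.univ.erase k,
        ({ω | η < c * Z k ω} ∩ {ω | η < c * Z l ω}).indicator (fun _ => (1 : ℝ)) ω := by
    intro ω
    have := abs_apply_sum_sub_sum_apply_le v hM h0 (show 0 ≤ ε / (2 * B) by positivity) hκ.le hκδ
      hη.le (min_le_left _ _) hηρ (fun x y hxy => (hFρ hxy).le) (fun k => c * Z k ω)
      fun k => hcZ k ω
    simp only [max_eq_left (hcZ _ ω), Finset.smul_sum, smul_smul]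
    refine this.trans (le_of_eq ?_)
    simp only [Set.indicator_apply, Set.mem_Ioi, Set.mem_ofPred_eq, Set.mem_inter_iff, ite_and,
      ite_mul, one_mul, zero_mul]
  have hj1 : ∀ k, Integrable ({ω | κ < c * Z k ω}.indicator fun _ => (1 : ℝ)) P := fun k =>
    (integrable_const _).indicator (hms _ _)
  have hj2 : ∀ k l, Integrable
      (({ω | η < c * Z k ω} ∩ {ω | η < c * Z l ω}).indicator fun _ => (1 : ℝ)) P := fun k l =>
    (integrable_const _).indicator ((hms _ _).inter (hms _ _))
  have hjs : Integrable (fun ω => ε / (2 * B) *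
      ∑ k, {ω | κ < c * Z k ω}.indicator (fun _ => (1 : ℝ)) ω) P :=
    (integrable_finsetSum _ fun k _ => hj1 k).const_mul _
  have hjd : Integrable (fun ω => (1 + Fintype.card ι) * M * ∑ k, ∑ l ∈ Finset.univ.erase k,
      ({ω | η < c * Z k ω} ∩ {ω | η < c * Z l ω}).indicator (fun _ => (1 : ℝ)) ω) P :=
    (integrable_finsetSum _ fun k _ => integrable_finsetSum _ fun l _ => hj2 k l).const_mul _
  have hprod : ∀ k, ∀ l ∈ Finset.univ.erase k,
      ∫ ω, ({ω | η < c * Z k ω} ∩ {ω | η < c * Z l ω}).indicator (fun _ => (1 : ℝ)) ω ∂P =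
      P.real {ω | η < c * Z k ω} * P.real {ω | η < c * Z l ω} := by
    intro k l hl
    rw [integral_indicator_fun_one ((hms _ _).inter (hms _ _))]
    have hS : MeasurableSet {x : ℝ | η < c * x} :=
      measurableSet_lt measurable_const (measurable_id.const_mul c)
    have := (hind.indepFun (Finset.ne_of_mem_erase hl).symm).measure_inter_preimage_eq_mul _ _ hS hS
    simp only [Measure.real]
    rw [← ENNReal.toReal_mul]
    exact congrArg ENNReal.toReal this
  have hmain := (abs_integral_le_integral_abs (μ := P)
    (f := fun ω => F (c • ∑ k, Z k ω • v k) - ∑ k, F (max (c * Z k ω) 0 • v k))).trans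
    (integral_mono (hi1.sub (integrable_finsetSum _ fun k _ => hi2 k)).abs (hjs.add hjd) hpt)
  rw [integral_sub hi1 (integrable_finsetSum _ fun k _ => hi2 k),
    integral_finsetSum _ fun k _ => hi2 k] at hmain
  have hR : ∫ ω, (ε / (2 * B) * ∑ k, {ω | κ < c * Z k ω}.indicator (fun _ => (1 : ℝ)) ω +
      (1 + Fintype.card ι) * M * ∑ k, ∑ l ∈ Finset.univ.erase k,
        ({ω | η < c * Z k ω} ∩ {ω | η < c * Z l ω}).indicator (fun _ => (1 : ℝ)) ω) ∂P =
      ε / (2 * B) * ∑ k, P.real {ω | κ < c * Z k ω} +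
      (1 + Fintype.card ι) * M * ∑ k, ∑ l ∈ Finset.univ.erase k,
        P.real {ω | η < c * Z k ω} * P.real {ω | η < c * Z l ω} := by
    rw [integral_add hjs hjd, integral_const_mul, integral_const_mul,
      integral_finsetSum _ fun k _ => hj1 k,
      integral_finsetSum _ fun k _ => integrable_finsetSum _ fun l _ => hj2 k l]
    congr 2
    · exact Finset.sum_congr rfl fun k _ => integral_indicator_fun_one (hms _ _)
    · refine Finset.sum_congr rfl fun k _ => ?_
      rw [integral_finsetSum _ fun l _ => hj2 k l]
      exact Finset.sum_congr rfl fun l hl => hprod k l hl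
  have hn : (0 : ℝ) ≤ n := n.cast_nonneg
  have hmain' := mul_le_mul_of_nonneg_left (hmain.trans_eq hR) hn
  rw [← abs_of_nonneg hn, ← abs_mul, abs_of_nonneg hn, mul_sub, Finset.mul_sum] at hmain'
  refine hmain'.trans ?_
  have h3 := mul_le_mul_of_nonneg_left h1.le (show 0 ≤ ε / (2 * B) by positivity)
  have h4 : ε / (2 * B) * B = ε / 2 := by field_simp
  rw [h4] at h3
  simp only [← Finset.mul_sum] at h2 h3
  calc _ = ε / (2 * B) * (n * ∑ k, P.real {ω | κ < c * Z k ω}) +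
      (1 + Fintype.card ι) * M * (n * ∑ k, ∑ l ∈ Finset.univ.erase k,
        P.real {ω | η < c * Z k ω} * P.real {ω | η < c * Z l ω}) := by ring
    _ ≤ ε := by simp only [← Finset.mul_sum]; linarith

/-! ### Test functions in polar coordinates -/

theorem exists_forall_ofReal_eq_zero {E : Type*} {f : ℝ≥0∞ × E → ℝ} {δ : ℝ≥0∞} (hδ : 0 < δ)
    (h0 : ∀ r < δ, ∀ θ, f (r, θ) = 0) :
    ∃ δ' : ℝ, 0 < δ' ∧ (∀ r < δ', ∀ θ, f (ENNReal.ofReal r, θ) = 0) := by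
  have hfin : min δ 1 ≠ ∞ := ne_top_of_le_ne_top ENNReal.one_ne_top (min_le_right _ _)
  refine ⟨(min δ 1).toReal, ENNReal.toReal_pos (by simp [hδ.ne']) hfin, fun r hr θ => h0 _ ?_ _⟩
  refine lt_of_lt_of_le ?_ (min_le_left δ 1)
  rw [← ENNReal.ofReal_toReal hfin]
  exact (ENNReal.ofReal_lt_ofReal_iff (ENNReal.toReal_pos (by simp [hδ.ne']) hfin)).2 hr

section Polar

variable {E : Type*} [NormedAddCommGroup E] [NormedSpace ℝ E]

/-- A function of radius and direction, as a function on the space. -/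
noncomputable def polarFun (f : ℝ≥0∞ × E → ℝ) (x : E) : ℝ :=
  f (ENNReal.ofReal ‖x‖, ‖x‖⁻¹ • x)

/-- The map `x ↦ x / (1 + ‖x‖)`, which compactifies the space radially to the closed unit ball. -/
noncomputable def ballMap (x : E) : E := (1 + ‖x‖)⁻¹ • x

/-- The function on the closed unit ball that `polarFun f` induces through `ballMap`. -/
noncomputable def ballFun (f : ℝ≥0∞ × E → ℝ) (y : E) : ℝ :=
  f (ENNReal.ofReal ‖y‖ / ENNReal.ofReal (1 - ‖y‖), ‖y‖⁻¹ • y)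

theorem norm_ballMap (x : E) : ‖ballMap x‖ = ‖x‖ / (1 + ‖x‖) := by
  rw [ballMap, norm_smul, Real.norm_of_nonneg (by positivity), div_eq_inv_mul]

theorem ballMap_mem (x : E) : ballMap x ∈ Metric.closedBall (0 : E) 1 := by
  rw [mem_closedBall_zero_iff, norm_ballMap, div_le_one (by positivity)]
  linarith [norm_nonneg x]

theorem dist_ballMap_le (x y : E) : dist (ballMap x) (ballMap y) ≤ 2 * dist x y := by
  have hx := norm_nonneg x
  have hy := norm_nonneg y
  have h : ballMap x - ballMap y =
      (1 + ‖x‖)⁻¹ • (x - y) + ((‖y‖ - ‖x‖) * (1 + ‖x‖)⁻¹) • ballMap y := by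
    have : (1 + ‖y‖)⁻¹ = (1 + ‖x‖)⁻¹ - ((‖y‖ - ‖x‖) * (1 + ‖x‖)⁻¹) * (1 + ‖y‖)⁻¹ := by
      field_simp; ring
    simp only [ballMap, smul_smul, smul_sub]
    rw [sub_add_eq_add_sub, sub_eq_sub_iff_add_eq_add, add_assoc, ← add_smul]
    congr 2
    linear_combination -this
  have h1 : (1 + ‖x‖)⁻¹ ≤ 1 := inv_le_one_of_one_le₀ (by linarith)
  have h2 : ‖ballMap y‖ ≤ 1 := mem_closedBall_zero_iff.1 (ballMap_mem y)
  have h3 : |‖y‖ - ‖x‖| ≤ ‖x - y‖ := by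
    rw [abs_sub_comm]; exact abs_norm_sub_norm_le x y
  have h0 : 0 ≤ (1 + ‖x‖)⁻¹ := by positivity
  rw [dist_eq_norm, dist_eq_norm, h]
  refine (norm_add_le _ _).trans ?_
  rw [norm_smul, norm_smul, Real.norm_of_nonneg h0, norm_mul, Real.norm_of_nonneg h0,
    Real.norm_eq_abs]
  have h4 : (1 + ‖x‖)⁻¹ * ‖x - y‖ ≤ 1 * ‖x - y‖ := mul_le_mul_of_nonneg_right h1 (norm_nonneg _)
  have h5 : |‖y‖ - ‖x‖| * (1 + ‖x‖)⁻¹ * ‖ballMap y‖ ≤ ‖x - y‖ * 1 * 1 := by gcongr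
  linarith

theorem ballFun_ballMap (f : ℝ≥0∞ × E → ℝ) (x : E) : ballFun f (ballMap x) = polarFun f x := by
  have hx := norm_nonneg x
  have h1 : 1 - ‖ballMap x‖ = (1 + ‖x‖)⁻¹ := by
    rw [norm_ballMap]; field_simp; ring
  have h2 : ENNReal.ofReal ‖ballMap x‖ / ENNReal.ofReal (1 - ‖ballMap x‖) =
      ENNReal.ofReal ‖x‖ := by
    rw [h1, ← ENNReal.ofReal_div_of_pos (by positivity), norm_ballMap]
    congr 1
    field_simp
  have h3 : ‖ballMap x‖⁻¹ • ballMap x = ‖x‖⁻¹ • x := by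
    rw [norm_ballMap, ballMap, smul_smul]
    congr 1
    field_simp
  rw [ballFun, h2, h3, polarFun]

theorem continuous_ballFun {f : ℝ≥0∞ × E → ℝ} (hf : Continuous f) {δ : ℝ≥0∞} (hδ : 0 < δ)
    (h0 : ∀ r < δ, ∀ θ, f (r, θ) = 0) : Continuous (ballFun f) := by
  have hr : Continuous fun y : E => ENNReal.ofReal ‖y‖ / ENNReal.ofReal (1 - ‖y‖) := by
    refine continuous_iff_continuousAt.2 fun y => ?_
    refine ENNReal.Tendsto.div (ENNReal.continuous_ofReal.comp continuous_norm).continuousAt ?_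
      (ENNReal.continuous_ofReal.comp (continuous_const.sub continuous_norm)).continuousAt ?_
    · by_cases hy : y = 0
      · right; simp [hy]
      · left; simpa using hy
    · left; exact ENNReal.ofReal_ne_top
  refine continuous_iff_continuousAt.2 fun y => ?_
  -- The direction is discontinuous at the origin, but the function vanishes near it.
  by_cases hy : y = 0
  · have hlt : ∀ᶠ z in 𝓝 y, ENNReal.ofReal ‖z‖ / ENNReal.ofReal (1 - ‖z‖) < δ :=
      hr.continuousAt.eventually (gt_mem_nhds (by simpa [hy] using hδ))
    exact (continuousAt_const (y := (0 : ℝ))).congr (hlt.mono fun z hz => (h0 _ hz _).symm)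
  · exact hf.continuousAt.comp (hr.continuousAt.prodMk
      ((continuous_norm.continuousAt.inv₀ (by simpa using hy)).smul continuousAt_id))

/-- A continuous function on `[0, ∞] × E` that vanishes for small radii becomes uniformly continuous
on the finite-dimensional space `E`, since it extends to the radial compactification of `E`. -/
theorem uniformContinuous_polarFun [FiniteDimensional ℝ E] {f : ℝ≥0∞ × E → ℝ} (hf : Continuous f)
    {δ : ℝ≥0∞} (hδ : 0 < δ) (h0 : ∀ r < δ, ∀ θ, f (r, θ) = 0) :
    UniformContinuous (polarFun f) := by
  have : ProperSpace E := FiniteDimensional.proper ℝ E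
  have hu := (isCompact_closedBall (0 : E) 1).uniformContinuousOn_of_continuous
    (continuous_ballFun hf hδ h0).continuousOn
  rw [Metric.uniformContinuousOn_iff] at hu
  refine Metric.uniformContinuous_iff.2 fun ε hε => ?_
  obtain ⟨r, hr, h⟩ := hu ε hε
  refine ⟨r / 2, by positivity, fun {x y} hxy => ?_⟩
  rw [← ballFun_ballMap, ← ballFun_ballMap]
  exact h _ (ballMap_mem x) _ (ballMap_mem y) (by linarith [dist_ballMap_le x y])

theorem exists_bound_polarFun [FiniteDimensional ℝ E] {f : ℝ≥0∞ × E → ℝ} (hf : Continuous f)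
    {δ : ℝ≥0∞} (hδ : 0 < δ) (h0 : ∀ r < δ, ∀ θ, f (r, θ) = 0) :
    ∃ M, ∀ x, |polarFun f x| ≤ M := by
  have : ProperSpace E := FiniteDimensional.proper ℝ E
  obtain ⟨M, hM⟩ := (isCompact_closedBall (0 : E) 1).exists_bound_of_continuousOn
    (continuous_ballFun hf hδ h0).continuousOn
  exact ⟨M, fun x => by simpa [ballFun_ballMap] using hM _ (ballMap_mem x)⟩

theorem polarFun_smul (f : ℝ≥0∞ × E → ℝ) {c : ℝ} (hc : 0 < c) (x : E) :
    polarFun f (c • x) = f (ENNReal.ofReal (c * ‖x‖), ‖x‖⁻¹ • x) := by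
  rw [polarFun, norm_smul, Real.norm_of_nonneg hc.le, smul_smul]
  congr 3
  field_simp

end Polar

/-! ### The angular measure of a linear combination of innovations -/

/-- The discrete angular measure with mass `‖v k‖ ^ α` in the direction of each `v k`. -/
noncomputable def rayMeasure {ι : Type*} [Fintype ι] {d : ℕ} (α : ℝ)
    (v : ι → EuclideanSpace ℝ (Fin d)) : Measure (EuclideanSpace ℝ (Fin d)) :=
  ∑ k, ENNReal.ofReal (‖v k‖ ^ α) • Measure.dirac (‖v k‖⁻¹ • v k)

theorem integral_rayMeasure {ι : Type*} [Fintype ι] {d : ℕ} (α : ℝ)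
    (v : ι → EuclideanSpace ℝ (Fin d)) (h : EuclideanSpace ℝ (Fin d) → ℝ) :
    ∫ θ, h θ ∂(rayMeasure α v) = ∑ k, ‖v k‖ ^ α * h (‖v k‖⁻¹ • v k) := by
  rw [rayMeasure, integral_finsetSum_measure]
  · refine Finset.sum_congr rfl fun k _ => ?_
    rw [integral_smul_measure, integral_dirac, ENNReal.toReal_ofReal (by positivity), smul_eq_mul]
  · intro k _
    exact (integrable_dirac (by simp)).smul_measure ENNReal.ofReal_ne_top

/-- A linear combination of independent standardised innovations with non-negative coefficient
vectors is regularly varying, with angular measure carried by the directions of these vectors. -/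
theorem isAngularMeasure_rayMeasure {Ω ι : Type*} [MeasurableSpace Ω] {P : Measure Ω}
    [IsProbabilityMeasure P] [Fintype ι] {d : ℕ} {α : ℝ} (hα : 0 < α) {Z : ι → Ω → ℝ}
    (hZm : ∀ k, Measurable (Z k)) (hZ0 : ∀ k ω, 0 ≤ Z k ω) (hind : iIndepFun Z P)
    (hstd : ∀ k, IsStandardised P α (Z k)) {v : ι → EuclideanSpace ℝ (Fin d)}
    (hv : ∀ k, v k ≠ 0) (hv0 : ∀ k i, 0 ≤ v k i) {X : Ω → EuclideanSpace ℝ (Fin d)}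
    (hX : ∀ ω, X ω = ∑ k, Z k ω • v k) : IsAngularMeasure P α X (rayMeasure α v) where
  finite := by
    unfold rayMeasure
    refine ⟨?_⟩
    rw [Measure.finsetSum_apply]
    exact ENNReal.sum_lt_top.2 fun k _ => by simp
  carrier := by
    have hcl : IsClosed (posSphere d) := by
      refine (isClosed_eq continuous_norm continuous_const).inter ?_
      have hall : {θ : EuclideanSpace ℝ (Fin d) | ∀ i, 0 ≤ θ i} = ⋂ i, {θ | 0 ≤ θ i} := by
        ext; simp
      change IsClosed {θ : EuclideanSpace ℝ (Fin d) | ∀ i, 0 ≤ θ i}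
      rw [hall]
      exact isClosed_iInter fun i => isClosed_le continuous_const (by fun_prop)
    rw [rayMeasure, Measure.finsetSum_apply]
    refine Finset.sum_eq_zero fun k _ => ?_
    have hk : ‖v k‖⁻¹ • v k ∈ posSphere d := by
      refine ⟨?_, fun i => ?_⟩
      · rw [norm_smul, norm_inv, norm_norm, inv_mul_cancel₀ (norm_ne_zero_iff.2 (hv k))]
      · exact mul_nonneg (by positivity) (hv0 k i)
    simp [Measure.dirac_apply' _ hcl.measurableSet.compl, hk]
  tendsto := by
    rintro f ⟨δ, hδ, h0⟩
    obtain ⟨δ', hδ', h0'⟩ := exists_forall_ofReal_eq_zero hδ h0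
    have hu := uniformContinuous_polarFun f.continuous hδ h0
    obtain ⟨M, hM⟩ := exists_bound_polarFun f.continuous hδ h0
    have hmain := tendsto_integral_sum_smul hα hZm hZ0 hind hstd v hu hM hδ'
      fun x hx => h0' _ hx _
    have hint : ∀ k, Integrable (fun r : ℝ => f (ENNReal.ofReal r, ‖v k‖⁻¹ • v k))
        (radialMeasure α) := fun k => by
      refine integrable_radialMeasure hα (κ := δ' / 2) (M := M) ?_ (fun u hu => ?_) (by positivity)
        fun u hu => h0' u (by linarith) _
      · exact f.continuous.comp (ENNReal.continuous_ofReal.prodMk continuous_const)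
      · have hn : 0 < ‖v k‖ := norm_pos_iff.2 (hv k)
        have := hM ((u / ‖v k‖) • v k)
        rwa [polarFun_smul _ (by positivity), div_mul_cancel₀ _ hn.ne'] at this
    have hlim : ∫ p, f (ENNReal.ofReal p.1, p.2) ∂((radialMeasure α).prod (rayMeasure α v)) =
        ∑ k, ∫ u, polarFun f (max u 0 • v k) ∂(radialMeasure α) := by
      have hcf : Continuous fun p : ℝ × EuclideanSpace ℝ (Fin d) =>
          f (ENNReal.ofReal p.1, p.2) := f.continuous.comp
          ((ENNReal.continuous_ofReal.comp continuous_fst).prodMk continuous_snd)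
      have hprod : (radialMeasure α).prod (rayMeasure α v) =
          ∑ k, ENNReal.ofReal (‖v k‖ ^ α) •
            (radialMeasure α).map fun r => (r, ‖v k‖⁻¹ • v k) := by
        rw [rayMeasure, ← Measure.sum_fintype, Measure.prod_sum_right, Measure.sum_fintype]
        refine Finset.sum_congr rfl fun k _ => ?_
        rw [Measure.prod_smul_right, Measure.prod_dirac]
      rw [hprod, integral_finsetSum_measure]
      · refine Finset.sum_congr rfl fun k _ => ?_
        have hn : 0 < ‖v k‖ := norm_pos_iff.2 (hv k)
        rw [integral_smul_measure, integral_map (by fun_prop) hcf.aestronglyMeasurable,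
          ENNReal.toReal_ofReal (by positivity), smul_eq_mul,
          ← integral_radialMeasure_comp_mul hα _ hn]
        refine integral_congr_ae (Eventually.of_forall fun u => ?_)
        simp only
        rcases lt_or_ge 0 u with hu | hu
        · rw [max_eq_left hu.le, polarFun_smul _ hu, mul_comm]
        · rw [max_eq_right hu, h0' _ (lt_of_le_of_lt (by nlinarith) hδ')]
          simp [polarFun, h0 0 hδ]
      · intro k _
        refine Integrable.smul_measure ?_ ENNReal.ofReal_ne_top
        exact (integrable_map_measure hcf.aestronglyMeasurable (by fun_prop)).2 (hint k)
    rw [hlim]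
    refine hmain.congr' ?_
    filter_upwards [eventually_gt_atTop 0] with n hn
    have hn' : (0 : ℝ) < n := by exact_mod_cast hn
    congr 1
    refine integral_congr_ae (Eventually.of_forall fun ω => ?_)
    simp only
    rw [← hX, polarFun_smul _ (by positivity), neg_div, Real.rpow_neg hn'.le,
      inv_mul_eq_div]

/-! ### Uniqueness of angular integrals and the row sums -/

/-- A piecewise linear cutoff: `0` up to `1`, and `1` from `2` on. -/
noncomputable def cutoff (u : ℝ) : ℝ := max 0 (min u 2 - 1)

theorem cutoff_nonneg (u : ℝ) : 0 ≤ cutoff u := le_max_left _ _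

theorem abs_cutoff_le (u : ℝ) : |cutoff u| ≤ 1 := by
  rw [abs_of_nonneg (cutoff_nonneg u)]
  exact max_le zero_le_one (by linarith [min_le_right u 2])

theorem cutoff_of_le {u : ℝ} (hu : u ≤ 1) : cutoff u = 0 :=
  max_eq_left (by linarith [min_le_left u 2])

theorem uniformContinuous_cutoff : UniformContinuous cutoff := by
  refine LipschitzWith.uniformContinuous (K := 1) (LipschitzWith.of_dist_le_mul fun x y => ?_)
  rw [NNReal.coe_one, one_mul, Real.dist_eq, Real.dist_eq, cutoff, cutoff, max_comm 0, max_comm 0]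
  refine (abs_max_sub_max_le_abs _ _ _).trans ?_
  rw [sub_sub_sub_cancel_right]
  simpa using abs_min_sub_min_le_max x 2 y 2

theorem integral_cutoff_pos {α : ℝ} (hα : 0 < α) : 0 < ∫ u, cutoff u ∂(radialMeasure α) := by
  have hi : Integrable cutoff (radialMeasure α) :=
    integrable_radialMeasure hα uniformContinuous_cutoff.continuous (fun u _ => abs_cutoff_le u)
      one_pos fun u hu => cutoff_of_le hu
  have hj : Integrable ((Set.Ioi (2 : ℝ)).indicator fun _ => (1 : ℝ)) (radialMeasure α) :=
    (integrable_indicator_iff measurableSet_Ioi).2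
      (integrableOn_const (by rw [radialMeasure_Ioi hα two_pos]; exact ENNReal.ofReal_ne_top))
  refine lt_of_lt_of_le ?_ (integral_mono hj hi fun u => ?_)
  · rw [integral_indicator_fun_one measurableSet_Ioi, radialMeasure_real_Ioi hα two_pos]
    positivity
  · by_cases hu : 2 < u
    · simp only [Set.indicator_apply, Set.mem_Ioi, if_pos hu]
      exact le_max_of_le_right (by rw [min_eq_right hu.le]; norm_num)
    · simpa [Set.indicator_apply, hu] using cutoff_nonneg u

/-- The limit in the definition determines the angular integrals of all continuous functions. -/
theorem IsAngularMeasure.integral_eq {Ω : Type*} [MeasurableSpace Ω] {P : Measure Ω} {d : ℕ}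
    {α : ℝ} (hα : 0 < α) {X : Ω → EuclideanSpace ℝ (Fin d)}
    {H H' : Measure (EuclideanSpace ℝ (Fin d))} (hH : IsAngularMeasure P α X H)
    (hH' : IsAngularMeasure P α X H') {h : EuclideanSpace ℝ (Fin d) → ℝ} (hh : Continuous h) :
    ∫ θ, h θ ∂H = ∫ θ, h θ ∂H' := by
  have := hH.finite
  have := hH'.finite
  have hc : Continuous fun r : ℝ≥0∞ => cutoff (min r 2).toReal := by
    refine uniformContinuous_cutoff.continuous.comp ?_
    refine continuous_iff_continuousAt.2 fun r => ?_
    exact (ENNReal.tendsto_toReal (ne_top_of_le_ne_top ENNReal.ofNat_ne_top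
      (min_le_right r 2))).comp (continuous_id.min continuous_const).continuousAt
  -- Truncating the radius at `2` keeps `toReal` continuous at `∞` and does not affect the cutoff.
  let f : C(ℝ≥0∞ × EuclideanSpace ℝ (Fin d), ℝ) :=
    ⟨fun p => cutoff (min p.1 2).toReal * h p.2,
      (hc.comp continuous_fst).mul (hh.comp continuous_snd)⟩
  have hf : ∃ δ : ℝ≥0∞, 0 < δ ∧ ∀ r < δ, ∀ θ, f (r, θ) = 0 := by
    refine ⟨1, one_pos, fun r hr θ => ?_⟩
    have : cutoff (min r 2).toReal = 0 := by
      refine cutoff_of_le ?_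
      rw [← ENNReal.toReal_one]
      exact ENNReal.toReal_mono ENNReal.one_ne_top ((min_le_left _ _).trans hr.le)
    change cutoff (min r 2).toReal * h θ = 0
    rw [this, zero_mul]
  have hu := tendsto_nhds_unique (hH.tendsto f hf) (hH'.tendsto f hf)
  have hcut : ∀ u : ℝ, cutoff (min (ENNReal.ofReal u) 2).toReal = cutoff u := fun u => by
    have h2 : (2 : ℝ≥0∞) = ENNReal.ofReal 2 := by simp
    rw [h2, ← ENNReal.ofReal_min]
    rcases le_or_gt u 0 with hu | hu
    · rw [cutoff_of_le (hu.trans zero_le_one), ENNReal.ofReal_of_nonpos ((min_le_left _ _).trans hu)]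
      exact cutoff_of_le (by simp)
    · rw [ENNReal.toReal_ofReal (by positivity), cutoff, cutoff, min_assoc, min_self]
  have key : ∀ K : Measure (EuclideanSpace ℝ (Fin d)), IsFiniteMeasure K →
      ∫ p, f (ENNReal.ofReal p.1, p.2) ∂((radialMeasure α).prod K) =
        (∫ u, cutoff u ∂(radialMeasure α)) * ∫ θ, h θ ∂K := fun K _ => by
    rw [← integral_prod_mul]
    refine integral_congr_ae (Eventually.of_forall fun p => ?_)
    change cutoff (min (ENNReal.ofReal p.1) 2).toReal * h p.2 = _
    rw [hcut]
  rw [key H inferInstance, key H' inferInstance] at hu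
  exact mul_left_cancel₀ (integral_cutoff_pos hα).ne' hu

/-- If the `i`-th coordinate of the linear combination is standardised, the `α`-th powers of its
coefficients sum to one. -/
theorem sum_rpow_eq_one {Ω ι : Type*} [MeasurableSpace Ω] {P : Measure Ω}
    [IsProbabilityMeasure P] [Fintype ι] {d : ℕ} {α : ℝ} (hα : 0 < α) {Z : ι → Ω → ℝ}
    (hZm : ∀ k, Measurable (Z k)) (hZ0 : ∀ k ω, 0 ≤ Z k ω) (hind : iIndepFun Z P)
    (hstd : ∀ k, IsStandardised P α (Z k)) {v : ι → EuclideanSpace ℝ (Fin d)}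
    (hv0 : ∀ k i, 0 ≤ v k i) {X : Ω → EuclideanSpace ℝ (Fin d)}
    (hX : ∀ ω, X ω = ∑ k, Z k ω • v k) {i : Fin d} (hXi : IsStandardised P α fun ω => X ω i) :
    ∑ k, v k i ^ α = 1 := by
  have hXe : ∀ ω, X ω i = ∑ k, Z k ω * v k i := fun ω => by simp [hX]
  have hXm : Measurable fun ω => X ω i := by
    simp only [hXe]
    exact Finset.measurable_fun_sum _ fun k _ => (hZm k).mul_const _
  have hco : UniformContinuous fun x : EuclideanSpace ℝ (Fin d) => x i :=
    (EuclideanSpace.proj (𝕜 := ℝ) i).uniformContinuous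
  have hl1 := hXi.tendsto_integral hα hXm uniformContinuous_cutoff abs_cutoff_le one_pos
    fun u hu => cutoff_of_le hu
  have hl2 := tendsto_integral_sum_smul hα hZm hZ0 hind hstd v
    (uniformContinuous_cutoff.comp hco) (fun x => abs_cutoff_le (x i)) one_pos
    fun x hx => cutoff_of_le ((le_abs_self _).trans ((PiLp.norm_apply_le x i).trans hx.le))
  simp only [← hX] at hl2
  have hu := tendsto_nhds_unique hl1 hl2
  have hterm : ∀ k, ∫ u, (cutoff ∘ fun x : EuclideanSpace ℝ (Fin d) => x i) (max u 0 • v k)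
      ∂(radialMeasure α) = v k i ^ α * ∫ u, cutoff u ∂(radialMeasure α) := fun k => by
    rcases (hv0 k i).eq_or_lt with h | h
    · rw [← h, Real.zero_rpow hα.ne', zero_mul]
      refine integral_eq_zero_of_ae (Eventually.of_forall fun u => ?_)
      simp [← h, cutoff_of_le]
    · rw [← integral_radialMeasure_comp_mul hα _ h]
      refine integral_congr_ae (Eventually.of_forall fun u => ?_)
      simp only [Function.comp, PiLp.smul_apply, smul_eq_mul]
      rcases le_total 0 u with hu | hu
      · rw [max_eq_left hu, mul_comm]
      · rw [max_eq_right hu, zero_mul, cutoff_of_le zero_le_one, cutoff_of_le (by nlinarith)]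
  simp only [hterm, ← Finset.sum_mul] at hu
  exact (mul_right_cancel₀ (integral_cutoff_pos hα).ne' ((one_mul _).trans hu)).symm

/-! ### The coefficient matrix of the structural equation model -/

theorem IsDAG.wellFounded {V : Type*} [Finite V] {G : Digraph V} (hG : IsDAG G) :
    WellFounded (Relation.TransGen G.Adj) := by
  have : Std.Irrefl (Relation.TransGen G.Adj) := ⟨hG⟩
  exact Finite.wellFounded_of_trans_of_irrefl _

/-- `C` is a weight matrix of `G`, with `C i j` the weight of the edge `j → i`. -/
structure IsWeight {V : Type*} (G : Digraph V) (C : Matrix V V ℝ) : Prop where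
  pos : ∀ i j, G.Adj j i → 0 < C i j
  eq_zero : ∀ i j, ¬ G.Adj j i → C i j = 0

namespace IsWeight

theorem weight_nonneg {V : Type*} {G : Digraph V} {C : Matrix V V ℝ} (hC : IsWeight G C) (i j : V) : 0 ≤ C i j := by
  by_cases h : G.Adj j i
  · exact (hC.pos i j h).le
  · exact (hC.eq_zero i j h).ge

variable {V : Type*} [Fintype V] {G : Digraph V} {C : Matrix V V ℝ}

/-- On a DAG `I - C` has trivial kernel: `x = C x` forces `x = 0` node by node, ancestors first. -/
theorem eq_zero_of_fixed (hC : IsWeight G C) (hG : IsDAG G) {x : V → ℝ}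
    (hx : ∀ i, x i = ∑ j, C i j * x j) (i : V) : x i = 0 := by
  induction i using hG.wellFounded.induction with
  | _ i ih =>
    rw [hx i]
    refine Finset.sum_eq_zero fun j _ => ?_
    by_cases h : G.Adj j i
    · rw [ih j (.single h), mul_zero]
    · rw [hC.eq_zero i j h, zero_mul]

variable [DecidableEq V]

theorem isUnit_one_sub (hC : IsWeight G C) (hG : IsDAG G) : IsUnit (1 - C) := by
  rw [← Matrix.mulVec_injective_iff_isUnit]
  intro x y hxy
  rw [← sub_eq_zero]
  ext i
  refine hC.eq_zero_of_fixed hG (x := x - y) (fun i => ?_) i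
  have h : (1 - C).mulVec (x - y) = 0 := by rw [Matrix.mulVec_sub]; exact sub_eq_zero.2 hxy
  rw [Matrix.sub_mulVec, Matrix.one_mulVec, sub_eq_zero] at h
  exact congrFun h i

/-- The coefficient matrix `(I - C)⁻¹ S` satisfies the structural equations column by column. -/
theorem exists_coeff (hC : IsWeight G C) (hG : IsDAG G) (s : V → ℝ) :
    ∃ A : Matrix V V ℝ, ∀ i k, A i k = ∑ j, C i j * A j k + if i = k then s i else 0 := by
  refine ⟨(1 - C)⁻¹ * Matrix.diagonal s, fun i k => ?_⟩
  set A := (1 - C)⁻¹ * Matrix.diagonal s with hA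
  have h : (1 - C) * A = Matrix.diagonal s := by
    rw [hA, ← Matrix.mul_assoc, Matrix.mul_nonsing_inv _
      ((Matrix.isUnit_iff_isUnit_det _).1 (hC.isUnit_one_sub hG)), Matrix.one_mul]
  rw [Matrix.sub_mul, Matrix.one_mul, sub_eq_iff_eq_add'] at h
  simpa [Matrix.mul_apply, Matrix.diagonal_apply] using congrFun (congrFun h i) k

variable {s : V → ℝ} {A : Matrix V V ℝ}

theorem coeff_nonneg (hC : IsWeight G C) (hG : IsDAG G) (hs : ∀ i, 0 < s i)
    (hA : ∀ i k, A i k = ∑ j, C i j * A j k + if i = k then s i else 0) (i k : V) :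
    0 ≤ A i k := by
  induction i using hG.wellFounded.induction with
  | _ i ih =>
    rw [hA]
    refine add_nonneg (Finset.sum_nonneg fun j _ => ?_) (by split_ifs; exacts [(hs i).le, le_rfl])
    by_cases h : G.Adj j i
    · exact mul_nonneg (hC.pos i j h).le (ih j (.single h))
    · rw [hC.eq_zero i j h, zero_mul]

theorem coeff_diag_pos (hC : IsWeight G C) (hG : IsDAG G) (hs : ∀ i, 0 < s i)
    (hA : ∀ i k, A i k = ∑ j, C i j * A j k + if i = k then s i else 0) (i : V) :
    0 < A i i := by
  rw [hA, if_pos rfl]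
  exact add_pos_of_nonneg_of_pos (Finset.sum_nonneg fun j _ =>
    mul_nonneg (hC.weight_nonneg i j) (hC.coeff_nonneg hG hs hA j i)) (hs i)

theorem coeff_pos_of_isAncestor (hC : IsWeight G C) (hG : IsDAG G) (hs : ∀ i, 0 < s i)
    (hA : ∀ i k, A i k = ∑ j, C i j * A j k + if i = k then s i else 0) {i j k : V}
    (hij : IsAncestor G i j) (hik : 0 < A i k) : 0 < A j k := by
  have hedge : ∀ {i j}, G.Adj i j → 0 < A i k → 0 < A j k := fun {i j} h hi => by
    rw [hA]
    refine add_pos_of_pos_of_nonneg ?_ (by split_ifs; exacts [(hs j).le, le_rfl])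
    exact (mul_pos (hC.pos j i h) hi).trans_le (Finset.single_le_sum (f := fun l => C j l * A l k)
      (fun l _ => mul_nonneg (hC.weight_nonneg j l) (hC.coeff_nonneg hG hs hA l k))
      (Finset.mem_univ i))
  induction hij with
  | single h => exact hedge h hik
  | tail _ h ih => exact hedge h ih

/-- The support of row `i` consists of `i` and its ancestors. -/
theorem isAncestor_of_coeff_ne_zero (hC : IsWeight G C) (hG : IsDAG G)
    (hA : ∀ i k, A i k = ∑ j, C i j * A j k + if i = k then s i else 0) {i k : V}
    (hik : A i k ≠ 0) : i = k ∨ IsAncestor G k i := by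
  induction i using hG.wellFounded.induction with
  | _ i ih =>
    by_contra! hne
    rw [hA, if_neg hne.1, add_zero] at hik
    obtain ⟨j, -, hj⟩ := Finset.exists_ne_zero_of_sum_ne_zero hik
    have hadj : G.Adj j i := by
      by_contra h
      exact hj (by rw [hC.eq_zero i j h, zero_mul])
    rcases ih j (.single hadj) (right_ne_zero_of_mul hj) with rfl | h
    · exact hne.2 (.single hadj)
    · exact hne.2 (h.tail hadj)

/-- The solution of the structural equations is the coefficient matrix applied to the innovations. -/
theorem eq_sum_coeff (hC : IsWeight G C) (hG : IsDAG G)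
    (hA : ∀ i k, A i k = ∑ j, C i j * A j k + if i = k then s i else 0) {x z : V → ℝ}
    (hx : ∀ i, x i = ∑ j, C i j * x j + s i * z i) (i : V) : x i = ∑ k, A i k * z k := by
  rw [← sub_eq_zero]
  refine hC.eq_zero_of_fixed hG (x := fun i => x i - ∑ k, A i k * z k) (fun i => ?_) i
  have h : ∑ k, A i k * z k = ∑ j, C i j * ∑ k, A j k * z k + s i * z i := by
    calc ∑ k, A i k * z k
        = ∑ k, (∑ j, C i j * A j k * z k + if i = k then s i * z k else 0) := by
          refine Finset.sum_congr rfl fun k _ => ?_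
          rw [hA, add_mul, Finset.sum_mul]
          congr 1
          split_ifs <;> simp
      _ = _ := by
          rw [Finset.sum_add_distrib, Finset.sum_comm]
          simp [Finset.mul_sum, mul_assoc]
  simp only [mul_sub, Finset.sum_sub_distrib]
  rw [hx i, h]
  ring

end IsWeight

/-! ### Comparison of the rescaled maxima -/

theorem max_sq_sub_max_sq_le (x y : ℝ) {a : ℝ} (ha : 1 ≤ a) :
    max (x ^ 2) ((a * y) ^ 2) - max (x ^ 2) (y ^ 2) ≤ (a ^ 2 - 1) * y ^ 2 := by
  have h : 0 ≤ (a ^ 2 - 1) * y ^ 2 := mul_nonneg (by nlinarith) (sq_nonneg y)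
  rw [sub_le_iff_le_add]
  exact max_le (by linarith [le_max_left (x ^ 2) (y ^ 2)])
    (by linarith [le_max_right (x ^ 2) (y ^ 2), mul_pow a y 2])

theorem max_sq_sub_max_sq_lt {x y a : ℝ} (ha : 1 < a) (hy : 0 < y) (hxy : y < x) :
    max (x ^ 2) ((a * y) ^ 2) - max (x ^ 2) (y ^ 2) < (a ^ 2 - 1) * y ^ 2 := by
  have h : y ^ 2 < x ^ 2 := by nlinarith
  have ha2 : 0 < (a ^ 2 - 1) * y ^ 2 := mul_pos (by nlinarith) (by positivity)
  rw [max_eq_left h.le, sub_lt_iff_lt_add]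
  exact max_lt (by linarith) (by nlinarith)

end ExtremeLSEM

theorem mainTheorem1 {Ω : Type*} [MeasurableSpace Ω] (P : Measure Ω) [IsProbabilityMeasure P]
    {d : ℕ} (G : Digraph (Fin d)) (C : Matrix (Fin d) (Fin d) ℝ) (s : Fin d → ℝ)
    (Z X : Ω → EuclideanSpace ℝ (Fin d))
    (hZmeas : Measurable Z)
    (hZnonneg : ∀ ω i, 0 ≤ Z ω i)
    (hZindep : iIndepFun (fun (i : Fin d) (ω : Ω) => Z ω i) P)
    (hZstd : ∀ i, ExtremeLSEM.IsStandardised P 2 (fun ω => Z ω i))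
    (hX : ExtremeLSEM.IsLSEMPlus G C s Z X)
    (hXstd : ∀ i, ExtremeLSEM.IsStandardised P 2 (fun ω => X ω i)) :
    (∃ H, ExtremeLSEM.IsAngularMeasure P 2 X H) ∧
    ∀ H, ExtremeLSEM.IsAngularMeasure P 2 X H → ∀ j : Fin d,
      (ExtremeLSEM.IsSource G j ↔
        ∃ a : ℝ, 1 < a ∧ ∀ i, i ≠ j →
          ExtremeLSEM.sqScalingMax H i a j - ExtremeLSEM.sqScalingMax H i 1 j = a ^ 2 - 1) ∧
      (¬ ExtremeLSEM.IsSource G j →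
        ∀ a : ℝ, 1 < a → ∀ i, i ≠ j →
          ExtremeLSEM.sqScalingMax H i a j - ExtremeLSEM.sqScalingMax H i 1 j ≤ a ^ 2 - 1 ∧
          (ExtremeLSEM.IsAncestor G i j →
            ExtremeLSEM.sqScalingMax H i a j - ExtremeLSEM.sqScalingMax H i 1 j
              < a ^ 2 - 1)) := by
  open ExtremeLSEM in
  have hG := hX.dag
  have hC : IsWeight G C := ⟨hX.edge_pos, hX.nonedge⟩
  obtain ⟨A, hA⟩ := hC.exists_coeff hG s
  have hA0 : ∀ i k, 0 ≤ A i k := hC.coeff_nonneg hG hX.innov_pos hA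
  have hAd : ∀ i, 0 < A i i := hC.coeff_diag_pos hG hX.innov_pos hA
  have hv0 : ∀ k i, 0 ≤ (WithLp.toLp 2 fun i => A i k : EuclideanSpace ℝ (Fin d)) i :=
    fun k i => hA0 i k
  have hv : ∀ k, (WithLp.toLp 2 fun i => A i k : EuclideanSpace ℝ (Fin d)) ≠ 0 := fun k h =>
    (hAd k).ne' (congrArg (fun x : EuclideanSpace ℝ (Fin d) => x k) h)
  set v : Fin d → EuclideanSpace ℝ (Fin d) := fun k => WithLp.toLp 2 fun i => A i k with hvdef
  have hvA : ∀ k i, v k i = A i k := fun k i => rfl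
  have hXv : ∀ ω, X ω = ∑ k, Z ω k • v k := fun ω => by
    ext i
    have := hC.eq_sum_coeff hG hA (hX.eqn ω) i
    rw [this]
    simp [hvA, mul_comm]
  have hZm : ∀ k, Measurable fun ω => Z ω k := fun k =>
    (EuclideanSpace.proj (𝕜 := ℝ) k).continuous.measurable.comp hZmeas
  have hray : IsAngularMeasure P 2 X (rayMeasure 2 v) :=
    isAngularMeasure_rayMeasure two_pos hZm (fun k ω => hZnonneg ω k) hZindep hZstd hv hv0 hXv
  -- Standardisation of the components of `X` normalises the rows of `A`.
  have hrow : ∀ i, ∑ k, A i k ^ 2 = 1 := fun i => by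
    have := sum_rpow_eq_one two_pos hZm (fun k ω => hZnonneg ω k) hZindep hZstd hv0 hXv (hXstd i)
    simpa using this
  refine ⟨⟨_, hray⟩, fun H hH j => ?_⟩
  have hsq : ∀ i a, sqScalingMax H i a j = ∑ k, max (A i k ^ 2) ((a * A j k) ^ 2) := fun i a => by
    rw [sqScalingMax, hH.integral_eq two_pos hray (by fun_prop), integral_rayMeasure]
    refine Finset.sum_congr rfl fun k _ => ?_
    have hn : ‖v k‖ ≠ 0 := norm_ne_zero_iff.2 (hv k)
    rw [Real.rpow_two, mul_max_of_nonneg _ _ (by positivity)]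
    simp only [PiLp.smul_apply, smul_eq_mul, hvA]
    congr 1 <;> field_simp
  have hdiff : ∀ i a, sqScalingMax H i a j - sqScalingMax H i 1 j =
      ∑ k, (max (A i k ^ 2) ((a * A j k) ^ 2) - max (A i k ^ 2) (A j k ^ 2)) := fun i a => by
    rw [hsq, hsq, Finset.sum_sub_distrib]; simp
  have hbound : ∀ a : ℝ, a ^ 2 - 1 = ∑ k, (a ^ 2 - 1) * A j k ^ 2 := fun a => by
    rw [← Finset.mul_sum, hrow, mul_one]
  have hle : ∀ a : ℝ, 1 < a → ∀ i,
      sqScalingMax H i a j - sqScalingMax H i 1 j ≤ a ^ 2 - 1 := fun a ha i => by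
    rw [hdiff, hbound]
    exact Finset.sum_le_sum fun k _ => max_sq_sub_max_sq_le _ _ ha.le
  have hlt : ∀ a : ℝ, 1 < a → ∀ i, IsAncestor G i j →
      sqScalingMax H i a j - sqScalingMax H i 1 j < a ^ 2 - 1 := fun a ha i hij => by
    -- The rows have equal norm and `A i j = 0 < A j j`, so row `i` exceeds row `j` elsewhere.
    have hAij : A i j = 0 := by
      by_contra h
      rcases hC.isAncestor_of_coeff_ne_zero hG hA h with rfl | h
      · exact hG _ hij
      · exact hG _ (hij.trans h)
    obtain ⟨k, hk⟩ : ∃ k, A j k < A i k := by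
      by_contra! hall
      have : ∑ k, A i k ^ 2 < ∑ k, A j k ^ 2 := by
        refine Finset.sum_lt_sum (fun k _ => pow_le_pow_left₀ (hA0 i k) (hall k) 2)
          ⟨j, Finset.mem_univ j, ?_⟩
        rw [hAij, zero_pow two_ne_zero]
        exact pow_pos (hAd j) 2
      rw [hrow, hrow] at this
      exact lt_irrefl _ this
    rw [hdiff, hbound]
    exact Finset.sum_lt_sum (fun k _ => max_sq_sub_max_sq_le _ _ ha.le) ⟨k, Finset.mem_univ k,
      max_sq_sub_max_sq_lt ha (hC.coeff_pos_of_isAncestor hG hX.innov_pos hA hij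
        ((hA0 j k).trans_lt hk)) hk⟩
  refine ⟨⟨fun hj => ⟨2, one_lt_two, fun i _ => ?_⟩, fun ⟨a, ha, h⟩ i hij => ?_⟩,
    fun _ a ha i _ => ⟨hle a ha i, hlt a ha i⟩⟩
  · have hz : ∀ k, k ≠ j → A j k = 0 := fun k hk => by
      by_contra h
      rcases hC.isAncestor_of_coeff_ne_zero hG hA h with rfl | h
      · exact hk rfl
      · obtain ⟨l, -, hl⟩ := Relation.TransGen.tail'_iff.1 h
        exact hj l hl
    have hjj : A j j ^ 2 = 1 := by
      rw [← hrow j, Finset.sum_eq_single j (fun k _ hk => by rw [hz k hk]; simp) (by simp)]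
    have hij : A i j ^ 2 ≤ 1 := by
      rw [← hrow i]
      exact Finset.single_le_sum (f := fun k => A i k ^ 2) (fun k _ => sq_nonneg _)
        (Finset.mem_univ j)
    rw [hdiff, Finset.sum_eq_single j (fun k _ hk => by
      rw [hz k hk, mul_zero, sub_self]) (by simp), mul_pow, hjj, max_eq_right hij,
      max_eq_right (by linarith)]
    norm_num
  · have hne : i ≠ j := fun h => hG j (by subst h; exact .single hij)
    exact (hlt a ha i (.single hij)).ne (h i hne)
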